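/- A 2-colored partition is a finite weakly decreasing sequence $\lambda=(\lambda_1,\dots,\lambda_\ell)$ ($\ell\ge 0$), whose entries (the parts) are ordinary positive integers $k$ or colored positive integers $\underline{k}$, with respect to the order $$\cdots>3>\underline{3}>2>\underline{2}>1>\underline{1}.$$ Put $\mathrm{cont}(k)=\mathrm{cont}(\underline{k})=k$, $\mathrm{color}(k)=+$ and $\mathrm{color}(\underline{k})=-$. The length of $\lambda$ is $\ell(\lambda)=\ell$, its number of parts, and its size is $|\lambda|=\mathrm{cont}(\lambda_1)+\dots+\mathrm{cont}(\lambda_\ell)$. We say that $\lambda$ contains $(\mu_1,\dots,\mu_m)$ if for some $0\le i\le \ell-m$ one has $\lambda_{i+j}=\mu_j$ for all $1\le j\le m$. Consider the conditions: (D1) If $1\le a<\ell$ and $\mathrm{cont}(\lambda_a)-\mathrm{cont}(\lambda_{a+1})\le 1$, then $\mathrm{cont}(\lambda_a)+\mathrm{cont}(\lambda_{a+1})\in 3\mathbb{Z}$ and $\mathrm{color}(\lambda_a)\ne\mathrm{color}(\lambda_{a+1})$. (D2) If $1\le a<\ell$, $\mathrm{cont}(\lambda_a)-\mathrm{cont}(\lambda_{a+1})=2$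 and $\mathrm{cont}(\lambda_a)+\mathrm{cont}(\lambda_{a+1})\notin 3\mathbb{Z}$, then $(\mathrm{color}(\lambda_a),\mathrm{color}(\lambda_{a+1}))\ne(-,+)$. (D3) For every $k\ge 1$, $\lambda$ contains none of $(3k,\underline{3k},\underline{3k-2})$, $(3k+2,3k,\underline{3k})$ and $(\underline{3k+2},3k+1,3k-1,\underline{3k-2})$. (D4) None of $1$, $\underline{1}$, $\underline{2}$ is a part of $\lambda$. Let $\mathsf{BIR}$ be the set of 2-colored partitions satisfying (D1)–(D3), and $\mathsf{BIR}'$ the set of those satisfying (D1)–(D4). Write $(z;q)_n=\prod_{0\le j<n}(1-zq^j)$. **Theorem 1.4.** As formal power series in $x$ and $q$ with integer coefficients (all sums below converge coefficientwise), $$\sum_{\lambda\in\mathsf{BIR}}x^{\ell(\lambda)}q^{|\lambda|}=\sum_{a,b,c,d\ge 0}\frac{q^{a^2+b^2+3c^2+3d^2+2ab+3ac+3ad+3bc+3bd+6cd}\,x^{a+b+2c+2d}}{(q;q)_a(q;q)_b(q^3;q^3)_c(q^3;q^3)_d},$$ $$\sum_{\lambda\in\mathsf{BIR}'}x^{\ell(\lambda)}q^{|\lambda|}=\sum_{a,b,c,d\ge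 0}\frac{q^{a(a+1)+b(b+2)+3c(c+1)+3d(d+1)+2ab+3ac+3ad+3bc+3bd+6cd}\,x^{a+b+2c+2d}}{(q;q)_a(q;q)_b(q^3;q^3)_c(q^3;q^3)_d}.$$ -/

import Mathlib

open PowerSeries
open scoped PowerSeries.WithPiTopology

namespace TwoColored

/-- The two colors: `plus` is the color of an ordinary positive integer `k`, `minus` the color of
an underlined (colored) positive integer. -/
inductive Color
  | plus
  | minus
  deriving DecidableEq

/-- A letter consisting of a natural number (its content) and a color.  Positivity of the content
is imposed on the parts of a partition. -/
@[ext]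
structure Part where
  cont : ℕ
  color : Color
  deriving DecidableEq

/-- The order `⋯ > 3 > 3̲ > 2 > 2̲ > 1 > 1̲`, where `k̲` is the colored copy of `k`:
`p ≤ r` iff the content of `p` is smaller, or the contents agree and `p` is colored `minus` or
`r` is colored `plus`. -/
instance : LE Part where
  le p r := p.cont < r.cont ∨
    (p.cont = r.cont ∧ (p.color = Color.minus ∨ r.color = Color.plus))

/-- A 2-colored partition: a finite weakly decreasing sequence of (ordinary or colored) positive
integers. -/
@[ext]
structure Partition where
  parts : List Part
  pos : ∀ p ∈ parts, 0 < p.cont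
  decreasing : parts.Pairwise (fun p r => r ≤ p)

namespace Partition

/-- The length: the number of parts. -/
def length (l : Partition) : ℕ := l.parts.length

/-- The size: the sum of the contents of the parts. -/
def size (l : Partition) : ℕ := (l.parts.map Part.cont).sum

/-- `l` contains `m` as a block of consecutive parts. -/
def Contains (l : Partition) (m : List Part) : Prop := m <:+: l.parts

/-- (D1): consecutive parts whose contents differ by at most 1 have contents summing to a
multiple of 3 and have different colors. -/
def D1 (l : Partition) : Prop :=
  ∀ p r : Part, l.Contains [p, r] → p.cont ≤ r.cont + 1 →
    3 ∣ p.cont + r.cont ∧ p.color ≠ r.color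

/-- (D2): consecutive parts whose contents differ by exactly 2 and whose contents do not sum to a
multiple of 3 do not have the color pattern `(-, +)`. -/
def D2 (l : Partition) : Prop :=
  ∀ p r : Part, l.Contains [p, r] → p.cont = r.cont + 2 → ¬ 3 ∣ p.cont + r.cont →
    ¬ (p.color = Color.minus ∧ r.color = Color.plus)

/-- (D3): three families of forbidden blocks of consecutive parts. -/
def D3 (l : Partition) : Prop :=
  ∀ k : ℕ, 1 ≤ k →
    ¬ l.Contains [⟨3 * k, Color.plus⟩, ⟨3 * k, Color.minus⟩, ⟨3 * k - 2, Color.minus⟩] ∧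
    ¬ l.Contains [⟨3 * k + 2, Color.plus⟩, ⟨3 * k, Color.plus⟩, ⟨3 * k, Color.minus⟩] ∧
    ¬ l.Contains [⟨3 * k + 2, Color.minus⟩, ⟨3 * k + 1, Color.plus⟩,
        ⟨3 * k - 1, Color.plus⟩, ⟨3 * k - 2, Color.minus⟩]

/-- (D4): neither of the two copies of 1, nor the colored copy of 2, is a part. -/
def D4 (l : Partition) : Prop :=
  (⟨1, Color.plus⟩ : Part) ∉ l.parts ∧ (⟨1, Color.minus⟩ : Part) ∉ l.parts ∧
    (⟨2, Color.minus⟩ : Part) ∉ l.parts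

end Partition

/-- The set of 2-colored partitions satisfying (D1), (D2), (D3). -/
def BIR : Set Partition := {l | l.D1 ∧ l.D2 ∧ l.D3}

/-- The set of 2-colored partitions satisfying (D1), (D2), (D3), (D4). -/
def BIRP : Set Partition := {l | l.D1 ∧ l.D2 ∧ l.D3 ∧ l.D4}

/-- The finite `q`-Pochhammer symbol `(a; q)_n = ∏_{0 ≤ j < n} (1 - a q^j)`, for formal power
series `a`, `q`. -/
noncomputable def qPoch (a q : ℤ⟦X⟧) (n : ℕ) : ℤ⟦X⟧ := ∏ j ∈ Finset.range n, (1 - a * q ^ j)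

/-- The power series `1 / ((q;q)_a (q;q)_b (q³;q³)_c (q³;q³)_d)` in `ℤ⟦q⟧`. -/
noncomputable def invDenom (a b c d : ℕ) : ℤ⟦X⟧ :=
  invOfUnit (qPoch X X a * qPoch X X b * qPoch (X ^ 3) (X ^ 3) c * qPoch (X ^ 3) (X ^ 3) d) 1

theorem constantCoeff_qPoch {a : ℤ⟦X⟧} (q : ℤ⟦X⟧) (ha : constantCoeff a = 0) (n : ℕ) :
    constantCoeff (qPoch a q n) = 1 := by
  simp [qPoch, map_prod, ha]

/-- `invDenom` is the genuine inverse of the denominator. -/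
theorem denom_mul_invDenom (a b c d : ℕ) :
    (qPoch X X a * qPoch X X b * qPoch (X ^ 3) (X ^ 3) c * qPoch (X ^ 3) (X ^ 3) d) *
      invDenom a b c d = 1 := by
  apply mul_invOfUnit
  simp [constantCoeff_qPoch]

/-- The monomial-type series `x^i s(q)` in `ℤ⟦q⟧⟦x⟧`: the variable `x` is the outer variable, and
the inner power series ring `ℤ⟦q⟧` is the ring of coefficients. -/
noncomputable def xpow (i : ℕ) (s : ℤ⟦X⟧) : ℤ⟦X⟧⟦X⟧ := X ^ i * C s

/-- The term `x^{ℓ(l)} q^{|l|}` of the generating function. -/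
noncomputable def weight (l : Partition) : ℤ⟦X⟧⟦X⟧ := xpow l.length (X ^ l.size)

/-- The summand of the fourfold series for `BIR`. -/
noncomputable def termBIR (a b c d : ℕ) : ℤ⟦X⟧⟦X⟧ :=
  xpow (a + b + 2 * c + 2 * d)
    (X ^ (a ^ 2 + b ^ 2 + 3 * c ^ 2 + 3 * d ^ 2 + 2 * a * b + 3 * a * c + 3 * a * d
        + 3 * b * c + 3 * b * d + 6 * c * d) * invDenom a b c d)

/-- The summand of the fourfold series for `BIRP`. -/
noncomputable def termBIRP (a b c d : ℕ) : ℤ⟦X⟧⟦X⟧ :=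
  xpow (a + b + 2 * c + 2 * d)
    (X ^ (a * (a + 1) + b * (b + 2) + 3 * c * (c + 1) + 3 * d * (d + 1) + 2 * a * b + 3 * a * c
        + 3 * a * d + 3 * b * c + 3 * b * d + 6 * c * d) * invDenom a b c d)

end TwoColored

/-!
A partition in `BIR` has distinct parts, and it is built by running through the letters
`1̲ < 1 < 2̲ < 2 < 3̲ < ⋯` and deciding for each one whether to put it on top of the parts chosen so
far. Whether a letter is allowed depends on at most three of the largest parts already present, and
the rule is periodic: raising all contents by `3` preserves it and amounts to `x ↦ x q ^ 3`. Hence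
the generating functions of the continuations of a partial partition fall into finitely many
classes, and they are related by `F = F' + x q ^ c F''` (leave out or take the next letter of
content `c`).

On the other side, let `quadSum i j k l` be the quadruple sum with the linear form
`i a + j b + k c + l d` added to the exponent of `q`; the two right-hand sides are `quadSum 0 0 0 0`
and `quadSum 1 2 3 3`. Cancelling the last factor of one of the four `q`-factorials gives four
contiguous relations (`quadSum_succ₁` to `quadSum_succ₄`), each of the shape `F = F' + w F''`.

The point is that all but three of the classes of continuations have a single shifted quadruple
sum as their generating function, and the other three have a short combination of such sums
(`tailGF`). With these explicit values, the recursions for the continuations follow from the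
contiguous relations (`tailGF_zero` to `tailGF_five`, combined in `continuationGF_eq_add`). The
recursion has only one solution, because the generating function of the continuations by letters of
content at least `N` is `1` up to order `N` in `q`: iterating the recursion expresses
`quadSum 0 0 0 0`, the value before any decision, as the sum of the weights of the partitions in
`BIR` (`hasSum_listWeight`). Starting the iteration at the letter `2` instead, with the letters
`1̲, 1, 2̲` left out, gives `BIRP` and `quadSum 1 2 3 3`.
-/

namespace TwoColored

/-! ### Quadruple sums and their contiguous relations -/

theorem xpow_mul_xpow (m n : ℕ) (s t : ℤ⟦X⟧) : xpow m s * xpow n t = xpow (m + n) (s * t) := by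
  simp only [xpow, pow_add, map_mul]
  ring

theorem coeff_coeff_xpow_mul (m n i j : ℕ) (f : ℤ⟦X⟧⟦X⟧) :
    coeff n (coeff m (xpow i (X ^ j) * f)) =
      if i ≤ m ∧ j ≤ n then coeff (n - j) (coeff (m - i) f) else 0 := by
  rw [xpow, mul_assoc, coeff_X_pow_mul']
  split_ifs with h1 h2 h2
  · rw [coeff_C_mul, coeff_X_pow_mul', if_pos h2.2]
  · rw [coeff_C_mul, coeff_X_pow_mul', if_neg fun h => h2 ⟨h1, h⟩]
  · exact absurd h2.1 h1
  · simp

theorem coeff_xpow_of_ne {m i : ℕ} (h : m ≠ i) (s : ℤ⟦X⟧) : coeff m (xpow i s) = 0 := by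
  rw [xpow, coeff_X_pow_mul', coeff_C]
  split_ifs <;> first | rfl | omega

theorem qPoch_succ (a q : ℤ⟦X⟧) (n : ℕ) : qPoch a q (n + 1) = qPoch a q n * (1 - a * q ^ n) :=
  Finset.prod_range_succ _ _

theorem eq_invDenom {a b c d : ℕ} {f : ℤ⟦X⟧}
    (h : (qPoch X X a * qPoch X X b * qPoch (X ^ 3) (X ^ 3) c * qPoch (X ^ 3) (X ^ 3) d) * f = 1) :
    f = invDenom a b c d := by
  have h' := denom_mul_invDenom a b c d
  exact (left_inv_eq_right_inv (by rw [mul_comm]; exact h) h')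

theorem invDenom_succ₁ (a b c d : ℕ) :
    (1 - X ^ (a + 1)) * invDenom (a + 1) b c d = invDenom a b c d := by
  apply eq_invDenom
  refine Eq.trans ?_ (denom_mul_invDenom (a + 1) b c d)
  rw [qPoch_succ X X a]
  ring

theorem invDenom_succ₂ (a b c d : ℕ) :
    (1 - X ^ (b + 1)) * invDenom a (b + 1) c d = invDenom a b c d := by
  apply eq_invDenom
  refine Eq.trans ?_ (denom_mul_invDenom a (b + 1) c d)
  rw [qPoch_succ X X b]
  ring

theorem invDenom_succ₃ (a b c d : ℕ) :
    (1 - X ^ (3 * (c + 1))) * invDenom a b (c + 1) d = invDenom a b c d := by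
  apply eq_invDenom
  refine Eq.trans ?_ (denom_mul_invDenom a b (c + 1) d)
  rw [qPoch_succ (X ^ 3) (X ^ 3) c]
  ring

theorem invDenom_succ₄ (a b c d : ℕ) :
    (1 - X ^ (3 * (d + 1))) * invDenom a b c (d + 1) = invDenom a b c d := by
  apply eq_invDenom
  refine Eq.trans ?_ (denom_mul_invDenom a b c (d + 1))
  rw [qPoch_succ (X ^ 3) (X ^ 3) d]
  ring

/-- The summand of the quadruple sum whose exponent of `q` is the common quadratic form of the two
identities plus the linear form `i a + j b + k c + l d`. -/
noncomputable def quadTerm (i j k l : ℕ) (t : ℕ × ℕ × ℕ × ℕ) : ℤ⟦X⟧⟦X⟧ :=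
  xpow (t.1 + t.2.1 + 2 * t.2.2.1 + 2 * t.2.2.2)
    (X ^ ((t.1 + t.2.1) ^ 2 + 3 * (t.1 + t.2.1) * (t.2.2.1 + t.2.2.2)
        + 3 * (t.2.2.1 + t.2.2.2) ^ 2
        + (i * t.1 + j * t.2.1 + k * t.2.2.1 + l * t.2.2.2))
      * invDenom t.1 t.2.1 t.2.2.1 t.2.2.2)

theorem summable_quadTerm (i j k l : ℕ) : Summable (quadTerm i j k l) := by
  rw [WithPiTopology.summable_iff_summable_coeff]
  intro m
  apply summable_of_hasFiniteSupport
  apply ((Finset.range (m + 1) ×ˢ Finset.range (m + 1) ×ˢ Finset.range (m + 1) ×ˢ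
    Finset.range (m + 1)).finite_toSet).subset
  intro t ht
  have : m = t.1 + t.2.1 + 2 * t.2.2.1 + 2 * t.2.2.2 := by
    by_contra h
    exact ht (coeff_xpow_of_ne h _)
  simp only [Finset.coe_product, Finset.coe_range, Set.mem_prod, Set.mem_Iio]
  omega

/-- The quadruple sum with linear form `i a + j b + k c + l d` in the exponent of `q`. -/
noncomputable def quadSum (i j k l : ℕ) : ℤ⟦X⟧⟦X⟧ := ∑' t, quadTerm i j k l t

/-- The common mechanism of the contiguous relations: the difference of two quadruple sums is a
series without the terms outside the range of an injective shift `e` of the summation index. -/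
theorem quadSum_eq_add {i j k l i' j' k' l' i'' j'' k'' l'' : ℕ} (w : ℤ⟦X⟧⟦X⟧)
    (e : ℕ × ℕ × ℕ × ℕ → ℕ × ℕ × ℕ × ℕ) (he : Function.Injective e)
    (h₀ : ∀ t ∉ Set.range e, quadTerm i j k l t = quadTerm i' j' k' l' t)
    (h₁ : ∀ t, quadTerm i j k l (e t) =
      quadTerm i' j' k' l' (e t) + w * quadTerm i'' j'' k'' l'' t) :
    quadSum i j k l = quadSum i' j' k' l' + w * quadSum i'' j'' k'' l'' := by
  rw [← sub_eq_iff_eq_add', quadSum, quadSum, quadSum,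
    ← (summable_quadTerm i j k l).tsum_sub (summable_quadTerm i' j' k' l'),
    ← (summable_quadTerm i'' j'' k'' l'').tsum_mul_left, ← he.tsum_eq]
  · exact tsum_congr fun t => by rw [h₁, add_sub_cancel_left]
  · intro t ht
    by_contra h
    exact ht (sub_eq_zero.mpr (h₀ t h))

/-- Each contiguous relation reduces to an identity between coefficients: `1 - q ^ p` cancels the
last factor of a `q`-factorial in the denominator. -/
theorem xpow_contiguous {m n e₁ e₂ e₃ p u : ℕ} {s r : ℤ⟦X⟧} (h : (1 - X ^ p) * s = r)
    (h₂ : e₂ = e₁ + p) (h₃ : u + e₃ = e₁) {v : ℕ} (hm : m = v + n) :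
    xpow m (X ^ e₁ * s) = xpow m (X ^ e₂ * s) + xpow v (X ^ u) * xpow n (X ^ e₃ * r) := by
  subst h h₂ h₃ hm
  rw [xpow_mul_xpow]
  simp only [xpow, ← mul_add, ← map_add]
  congr 2
  ring

theorem quadSum_succ₁ (i j k l : ℕ) :
    quadSum i j k l =
      quadSum (i + 1) j k l + xpow 1 (X ^ (i + 1)) * quadSum (i + 2) (j + 2) (k + 3) (l + 3) := by
  refine quadSum_eq_add _ (fun t => (t.1 + 1, t.2)) ?_ ?_ ?_
  · rintro ⟨a, b⟩ ⟨a', b'⟩ h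
    simpa using h
  · rintro ⟨_ | a, b, c, d⟩ h
    · simp [quadTerm]
    · exact absurd ⟨(a, b, c, d), rfl⟩ h
  · rintro ⟨a, b, c, d⟩
    exact xpow_contiguous (invDenom_succ₁ a b c d) (by ring) (by ring) (by ring)

theorem quadSum_succ₂ (i j k l : ℕ) :
    quadSum i j k l =
      quadSum i (j + 1) k l + xpow 1 (X ^ (j + 1)) * quadSum (i + 2) (j + 2) (k + 3) (l + 3) := by
  refine quadSum_eq_add _ (fun t => (t.1, t.2.1 + 1, t.2.2)) ?_ ?_ ?_
  · rintro ⟨a, b, c⟩ ⟨a', b', c'⟩ h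
    simpa using h
  · rintro ⟨a, _ | b, c, d⟩ h
    · simp [quadTerm]
    · exact absurd ⟨(a, b, c, d), rfl⟩ h
  · rintro ⟨a, b, c, d⟩
    exact xpow_contiguous (invDenom_succ₂ a b c d) (by ring) (by ring) (by ring)

theorem quadSum_succ₃ (i j k l : ℕ) :
    quadSum i j k l =
      quadSum i j (k + 3) l + xpow 2 (X ^ (k + 3)) * quadSum (i + 3) (j + 3) (k + 6) (l + 6) := by
  refine quadSum_eq_add _ (fun t => (t.1, t.2.1, t.2.2.1 + 1, t.2.2.2)) ?_ ?_ ?_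
  · rintro ⟨a, b, c, d⟩ ⟨a', b', c', d'⟩ h
    simpa using h
  · rintro ⟨a, b, _ | c, d⟩ h
    · simp [quadTerm]
    · exact absurd ⟨(a, b, c, d), rfl⟩ h
  · rintro ⟨a, b, c, d⟩
    exact xpow_contiguous (invDenom_succ₃ a b c d) (by ring) (by ring) (by ring)

theorem quadSum_succ₄ (i j k l : ℕ) :
    quadSum i j k l =
      quadSum i j k (l + 3) + xpow 2 (X ^ (l + 3)) * quadSum (i + 3) (j + 3) (k + 6) (l + 6) := by
  refine quadSum_eq_add _ (fun t => (t.1, t.2.1, t.2.2.1, t.2.2.2 + 1)) ?_ ?_ ?_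
  · rintro ⟨a, b, c, d⟩ ⟨a', b', c', d'⟩ h
    simpa using h
  · rintro ⟨a, b, c, _ | d⟩ h
    · simp [quadTerm]
    · exact absurd ⟨(a, b, c, d), rfl⟩ h
  · rintro ⟨a, b, c, d⟩
    exact xpow_contiguous (invDenom_succ₄ a b c d) (by ring) (by ring) (by ring)

/-- The quadruple sum tends to `1` as the coefficients of its linear form grow. -/
theorem coeff_coeff_quadSum {i j k l m n : ℕ} (hi : n < i) (hj : n < j) (hk : n < k) (hl : n < l) :
    coeff n (coeff m (quadSum i j k l)) = if m = 0 ∧ n = 0 then 1 else 0 := by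
  have h := ((WithPiTopology.hasSum_iff_hasSum_coeff _).mp
    (((WithPiTopology.hasSum_iff_hasSum_coeff _).mp (summable_quadTerm i j k l).hasSum) m)) n
  rw [quadSum, ← h.tsum_eq, tsum_eq_single 0]
  · have h1 : invDenom 0 0 0 0 = 1 := (eq_invDenom (by simp [qPoch])).symm
    rcases eq_or_ne m 0 with rfl | hm
    · simp [quadTerm, xpow, h1, coeff_one]
    · simp [quadTerm, xpow, h1, coeff_one, hm]
  · rintro ⟨a, b, c, d⟩ ht
    rw [quadTerm, xpow, coeff_X_pow_mul', coeff_C]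
    split_ifs
    · rw [coeff_X_pow_mul', if_neg]
      simp only [ne_eq, Prod.mk_eq_zero, not_and_or] at ht
      rw [not_le]
      apply lt_of_lt_of_le _ (Nat.le_add_left _ _)
      rcases ht with ht | ht | ht | ht
      · nlinarith [Nat.pos_of_ne_zero ht, Nat.zero_le (j * b), Nat.zero_le (k * c), Nat.zero_le (l * d)]
      · nlinarith [Nat.pos_of_ne_zero ht, Nat.zero_le (i * a), Nat.zero_le (k * c), Nat.zero_le (l * d)]
      · nlinarith [Nat.pos_of_ne_zero ht, Nat.zero_le (i * a), Nat.zero_le (j * b), Nat.zero_le (l * d)]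
      · nlinarith [Nat.pos_of_ne_zero ht, Nat.zero_le (i * a), Nat.zero_le (j * b), Nat.zero_le (k * c)]
    · simp
    · simp

theorem termBIR_eq_quadTerm (t : ℕ × ℕ × ℕ × ℕ) :
    termBIR t.1 t.2.1 t.2.2.1 t.2.2.2 = quadTerm 0 0 0 0 t := by
  rw [termBIR, quadTerm]
  congr 3
  ring

theorem termBIRP_eq_quadTerm (t : ℕ × ℕ × ℕ × ℕ) :
    termBIRP t.1 t.2.1 t.2.2.1 t.2.2.2 = quadTerm 1 2 3 3 t := by
  rw [termBIRP, quadTerm]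
  congr 3
  ring

/-! ### Forbidden blocks and the letters that may be added on top of a partition -/

/-- The blocks of consecutive parts excluded by (D1), (D2) and (D3). -/
inductive Forbidden : List Part → Prop
  | close (p r : Part) : p.cont ≤ r.cont + 1 → ¬ (3 ∣ p.cont + r.cont ∧ p.color ≠ r.color) →
      Forbidden [p, r]
  | gap (c : ℕ) : ¬ 3 ∣ c + 2 + c → Forbidden [⟨c + 2, Color.minus⟩, ⟨c, Color.plus⟩]
  | above (k : ℕ) : 1 ≤ k →
      Forbidden [⟨3 * k, Color.plus⟩, ⟨3 * k, Color.minus⟩, ⟨3 * k - 2, Color.minus⟩]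
  | below (k : ℕ) : 1 ≤ k →
      Forbidden [⟨3 * k + 2, Color.plus⟩, ⟨3 * k, Color.plus⟩, ⟨3 * k, Color.minus⟩]
  | chain (k : ℕ) : 1 ≤ k →
      Forbidden [⟨3 * k + 2, Color.minus⟩, ⟨3 * k + 1, Color.plus⟩, ⟨3 * k - 1, Color.plus⟩,
        ⟨3 * k - 2, Color.minus⟩]

/-- No forbidden block sits at the large end of the list. -/
def TopAllowed (s : List Part) : Prop := ∀ m, Forbidden m → ¬ m <+: s

/-- The position of a letter in the order `1̲ < 1 < 2̲ < 2 < ⋯`; the letter `1̲` has rank `2`. -/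
def Part.rank (p : Part) : ℕ := 2 * p.cont + if p.color = Color.plus then 1 else 0

theorem Part.rank_injective : Function.Injective Part.rank := by
  rintro ⟨c, _ | _⟩ ⟨c', _ | _⟩ h <;> simp [Part.rank] at h ⊢ <;> omega

theorem Part.le_iff_rank_le (p r : Part) : p ≤ r ↔ p.rank ≤ r.rank := by
  change (p.cont < r.cont ∨ _) ↔ _
  obtain ⟨c, _ | _⟩ := p <;> obtain ⟨c', _ | _⟩ := r <;> simp [Part.rank] <;> omega

theorem topAllowed_cons_cons_iff {p a : Part} {s : List Part} :
    TopAllowed (p :: a :: s) ↔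
      (p.cont ≤ a.cont + 1 → 3 ∣ p.cont + a.cont ∧ p.color ≠ a.color) ∧
      (p.cont = a.cont + 2 → ¬ 3 ∣ p.cont + a.cont →
        ¬ (p.color = Color.minus ∧ a.color = Color.plus)) ∧
      ∀ k, 1 ≤ k →
        (p = ⟨3 * k, Color.plus⟩ → ¬ [⟨3 * k, Color.minus⟩, ⟨3 * k - 2, Color.minus⟩] <+: a :: s) ∧
        (p = ⟨3 * k + 2, Color.plus⟩ → ¬ [⟨3 * k, Color.plus⟩, ⟨3 * k, Color.minus⟩] <+: a :: s) ∧
        (p = ⟨3 * k + 2, Color.minus⟩ →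
          ¬ [⟨3 * k + 1, Color.plus⟩, ⟨3 * k - 1, Color.plus⟩, ⟨3 * k - 2, Color.minus⟩] <+: a :: s)
    := by
  constructor
  · refine fun h => ⟨fun h₁ => ?_, fun h₁ h₂ h₃ => ?_, fun k hk => ⟨?_, ?_, ?_⟩⟩
    · by_contra h₂
      exact h _ (.close p a h₁ h₂) ⟨s, rfl⟩
    · obtain ⟨c, _⟩ := p
      obtain ⟨c', _⟩ := a
      obtain ⟨rfl, rfl⟩ := h₃
      obtain rfl : c = c' + 2 := h₁
      exact h _ (.gap c' h₂) ⟨s, rfl⟩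
    · rintro rfl h₁
      exact h _ (.above k hk) (by simpa using h₁)
    · rintro rfl h₁
      exact h _ (.below k hk) (by simpa using h₁)
    · rintro rfl h₁
      exact h _ (.chain k hk) (by simpa using h₁)
  · rintro ⟨h₁, h₂, h₃⟩ m hm hs
    cases hm with
    | close p' r' h₄ h₅ =>
      simp only [List.cons_prefix_cons] at hs
      obtain ⟨rfl, rfl, -⟩ := hs
      exact h₅ (h₁ h₄)
    | gap c h₄ =>
      simp only [List.cons_prefix_cons] at hs
      obtain ⟨rfl, rfl, -⟩ := hs
      exact h₂ rfl h₄ ⟨rfl, rfl⟩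
    | above k hk =>
      rw [List.cons_prefix_cons] at hs
      exact (h₃ k hk).1 hs.1.symm hs.2
    | below k hk =>
      rw [List.cons_prefix_cons] at hs
      exact (h₃ k hk).2.1 hs.1.symm hs.2
    | chain k hk =>
      rw [List.cons_prefix_cons] at hs
      exact (h₃ k hk).2.2 hs.1.symm hs.2

theorem topAllowed_singleton (p : Part) : TopAllowed [p] := by
  rintro m (_ | _ | _ | _ | _) <;> simp

theorem topAllowed_minus_one_iff {r : ℕ} {s : List Part}
    (hs : ∀ a ∈ s, 0 < a.cont ∧ a.rank < 6 * r + 2) :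
    TopAllowed (⟨3 * r + 1, Color.minus⟩ :: s) ↔
      ¬ [⟨3 * r, Color.plus⟩] <+: s ∧ ¬ [⟨3 * r, Color.minus⟩] <+: s := by
  obtain _ | ⟨⟨c, _ | _⟩, s⟩ := s
  · simp [topAllowed_singleton]
  all_goals
    have := hs _ List.mem_cons_self
    simp [Part.rank] at this
    simp [topAllowed_cons_cons_iff]
    grind

theorem topAllowed_plus_one_iff {r : ℕ} {s : List Part}
    (hs : ∀ a ∈ s, 0 < a.cont ∧ a.rank < 6 * r + 3) :
    TopAllowed (⟨3 * r + 1, Color.plus⟩ :: s) ↔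
      ¬ [⟨3 * r + 1, Color.minus⟩] <+: s ∧ ¬ [⟨3 * r, Color.plus⟩] <+: s ∧
        ¬ [⟨3 * r, Color.minus⟩] <+: s := by
  obtain _ | ⟨⟨c, _ | _⟩, s⟩ := s
  · simp [topAllowed_singleton]
  all_goals
    have := hs _ List.mem_cons_self
    simp [Part.rank] at this
    simp [topAllowed_cons_cons_iff]
    grind

theorem topAllowed_minus_two_iff {r : ℕ} {s : List Part}
    (hs : ∀ a ∈ s, 0 < a.cont ∧ a.rank < 6 * r + 4) :
    TopAllowed (⟨3 * r + 2, Color.minus⟩ :: s) ↔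
      ¬ [⟨3 * r + 1, Color.minus⟩] <+: s ∧ ¬ [⟨3 * r, Color.plus⟩] <+: s ∧
        ¬ [⟨3 * r + 1, Color.plus⟩, ⟨3 * r - 1, Color.plus⟩, ⟨3 * r - 2, Color.minus⟩] <+: s := by
  obtain _ | ⟨⟨c, _ | _⟩, s⟩ := s
  · simp [topAllowed_singleton]
  all_goals
    have := hs _ List.mem_cons_self
    simp [Part.rank] at this
    -- For `r = 0` the truncated contents `3 * r - 1` and `3 * r - 2` are not those of parts
    have hpos : [⟨3 * r - 1, Color.plus⟩, ⟨3 * r - 2, Color.minus⟩] <+: s → 0 < 3 * r - 2 :=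
      fun h => (hs ⟨3 * r - 2, Color.minus⟩ (List.mem_cons_of_mem _ (h.subset (by simp)))).1
    simp [topAllowed_cons_cons_iff]
    grind

theorem topAllowed_plus_two_iff {r : ℕ} {s : List Part}
    (hs : ∀ a ∈ s, 0 < a.cont ∧ a.rank < 6 * r + 5) :
    TopAllowed (⟨3 * r + 2, Color.plus⟩ :: s) ↔
      ¬ [⟨3 * r + 2, Color.minus⟩] <+: s ∧ ¬ [⟨3 * r + 1, Color.plus⟩] <+: s ∧
        ¬ [⟨3 * r, Color.plus⟩, ⟨3 * r, Color.minus⟩] <+: s := by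
  obtain _ | ⟨⟨c, _ | _⟩, s⟩ := s
  · simp [topAllowed_singleton]
  all_goals
    have := hs _ List.mem_cons_self
    simp [Part.rank] at this
    simp [topAllowed_cons_cons_iff]
    grind

theorem topAllowed_minus_three_iff {r : ℕ} {s : List Part}
    (hs : ∀ a ∈ s, 0 < a.cont ∧ a.rank < 6 * r + 6) :
    TopAllowed (⟨3 * r + 3, Color.minus⟩ :: s) ↔
      ¬ [⟨3 * r + 2, Color.plus⟩] <+: s ∧ ¬ [⟨3 * r + 2, Color.minus⟩] <+: s ∧
        ¬ [⟨3 * r + 1, Color.plus⟩] <+: s := by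
  obtain _ | ⟨⟨c, _ | _⟩, s⟩ := s
  · simp [topAllowed_singleton]
  all_goals
    have := hs _ List.mem_cons_self
    simp [Part.rank] at this
    simp [topAllowed_cons_cons_iff]
    grind

theorem topAllowed_plus_three_iff {r : ℕ} {s : List Part}
    (hs : ∀ a ∈ s, 0 < a.cont ∧ a.rank < 6 * r + 7) :
    TopAllowed (⟨3 * r + 3, Color.plus⟩ :: s) ↔
      ¬ [⟨3 * r + 2, Color.plus⟩] <+: s ∧ ¬ [⟨3 * r + 2, Color.minus⟩] <+: s ∧
        ¬ [⟨3 * r + 3, Color.minus⟩, ⟨3 * r + 1, Color.minus⟩] <+: s := by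
  obtain _ | ⟨⟨c, _ | _⟩, s⟩ := s
  · simp [topAllowed_singleton]
  all_goals
    have := hs _ List.mem_cons_self
    simp [Part.rank] at this
    have hk : ∀ k, 3 * r + 3 = 3 * k ↔ k = r + 1 := by omega
    simp [topAllowed_cons_cons_iff, hk]
    grind

/-! ### The generating functions of the continuations of a partition -/

/-- `quadSum i j k l` after the substitution `x ↦ x q ^ (3 r)`. -/
noncomputable def shiftedSum (r i j k l : ℕ) : ℤ⟦X⟧⟦X⟧ :=
  quadSum (3 * r + i) (3 * r + j) (6 * r + k) (6 * r + l)

theorem shiftedSum_succ_left (r i j k l : ℕ) :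
    shiftedSum (r + 1) i j k l = shiftedSum r (i + 3) (j + 3) (k + 6) (l + 6) := by
  simp only [shiftedSum]
  congr 1 <;> ring

theorem shiftedSum_succ₁ (r i j k l : ℕ) :
    shiftedSum r i j k l = shiftedSum r (i + 1) j k l +
      xpow 1 (X ^ (3 * r + i + 1)) * shiftedSum r (i + 2) (j + 2) (k + 3) (l + 3) :=
  quadSum_succ₁ _ _ _ _

theorem shiftedSum_succ₂ (r i j k l : ℕ) :
    shiftedSum r i j k l = shiftedSum r i (j + 1) k l +
      xpow 1 (X ^ (3 * r + j + 1)) * shiftedSum r (i + 2) (j + 2) (k + 3) (l + 3) :=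
  quadSum_succ₂ _ _ _ _

theorem shiftedSum_succ₃ (r i j k l : ℕ) :
    shiftedSum r i j k l = shiftedSum r i j (k + 3) l +
      xpow 2 (X ^ (6 * r + k + 3)) * shiftedSum r (i + 3) (j + 3) (k + 6) (l + 6) :=
  quadSum_succ₃ _ _ _ _

theorem shiftedSum_succ₄ (r i j k l : ℕ) :
    shiftedSum r i j k l = shiftedSum r i j k (l + 3) +
      xpow 2 (X ^ (6 * r + l + 3)) * shiftedSum r (i + 3) (j + 3) (k + 6) (l + 6) :=
  quadSum_succ₄ _ _ _ _

theorem xpow_one_mul_mul (m n : ℕ) (f : ℤ⟦X⟧⟦X⟧) :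
    xpow 1 (X ^ m) * (xpow 1 (X ^ n) * f) = xpow 2 (X ^ (m + n)) * f := by
  rw [← mul_assoc, xpow_mul_xpow, ← pow_add]

/-! The next nine relations are the recursions satisfied by the values of `tailGF` wherever taking
the next letter is allowed and the recursion is not an identity by definition. -/

theorem shiftedSum_0003 (r : ℕ) : shiftedSum r 0 0 0 3 =
    shiftedSum r 0 1 3 3 + xpow 1 (X ^ (3 * r + 1)) * shiftedSum r 1 2 3 6 := by
  rw [shiftedSum_succ₂ r 0 0 0 3, shiftedSum_succ₃ r 0 1 0 3, shiftedSum_succ₁ r 1 2 3 6, mul_add,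
    xpow_one_mul_mul, add_assoc, add_comm (xpow 2 _ * _)]
  ring_nf

theorem shiftedSum_0133 (r : ℕ) : shiftedSum r 0 1 3 3 =
    shiftedSum r 1 1 3 3 + xpow 1 (X ^ (3 * r + 1)) * shiftedSum r 2 3 6 6 :=
  shiftedSum_succ₁ r 0 1 3 3

theorem shiftedSum_0000 (r : ℕ) : shiftedSum r 0 0 0 0 =
    shiftedSum r 1 1 3 3 + xpow 1 (X ^ (3 * r + 1)) * (shiftedSum r 2 3 6 6 +
      xpow 1 (X ^ (3 * r + 2)) * shiftedSum r 3 3 6 6) +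
      xpow 1 (X ^ (3 * r + 1)) * shiftedSum r 1 2 3 6 := by
  rw [shiftedSum_succ₄ r 0 0 0 0, shiftedSum_0003, shiftedSum_0133, mul_add, xpow_one_mul_mul]
  ring_nf

theorem shiftedSum_1133 (r : ℕ) : shiftedSum r 1 1 3 3 =
    shiftedSum r 1 2 3 3 + xpow 1 (X ^ (3 * r + 2)) * shiftedSum r 3 3 6 6 :=
  shiftedSum_succ₂ r 1 1 3 3

theorem shiftedSum_1233 (r : ℕ) : shiftedSum r 1 2 3 3 =
    shiftedSum r 2 2 3 6 + xpow 1 (X ^ (3 * r + 2)) * shiftedSum r 3 3 6 6 := by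
  rw [shiftedSum_succ₁ r 1 2 3 3, shiftedSum_succ₄ r 2 2 3 3, shiftedSum_succ₂ r 3 3 6 6, mul_add,
    xpow_one_mul_mul, add_assoc, add_comm (xpow 2 _ * _)]
  ring_nf

theorem shiftedSum_1236 (r : ℕ) : shiftedSum r 1 2 3 6 =
    shiftedSum r 2 2 6 6 + xpow 1 (X ^ (3 * r + 2)) * shiftedSum r 3 3 6 9 := by
  rw [shiftedSum_succ₁ r 1 2 3 6, shiftedSum_succ₃ r 2 2 3 6, shiftedSum_succ₂ r 3 3 6 9, mul_add,
    xpow_one_mul_mul, add_assoc, add_comm (xpow 2 _ * _)]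
  ring_nf

theorem shiftedSum_2266 (r : ℕ) : shiftedSum r 2 2 6 6 =
    shiftedSum r 2 3 6 6 + xpow 1 (X ^ (3 * r + 3)) * shiftedSum r 4 4 9 9 :=
  shiftedSum_succ₂ r 2 2 6 6

theorem shiftedSum_2236 (r : ℕ) : shiftedSum r 2 2 3 6 =
    shiftedSum r 2 3 6 6 + xpow 1 (X ^ (3 * r + 3)) * (shiftedSum r 4 4 9 9 +
      xpow 1 (X ^ (3 * r + 3)) * shiftedSum r 5 5 9 12) := by
  rw [shiftedSum_succ₃ r 2 2 3 6, shiftedSum_2266, mul_add, xpow_one_mul_mul]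
  ring_nf

theorem shiftedSum_2366 (r : ℕ) : shiftedSum r 2 3 6 6 =
    shiftedSum r 3 3 6 6 + xpow 1 (X ^ (3 * r + 3)) * shiftedSum r 4 5 9 9 :=
  shiftedSum_succ₁ r 2 3 6 6

/-- Closed forms for the generating function of the continuations of the partition `s` by larger
parts, when the first `t < 6` of the letters `3r+1̲ < 3r+1 < 3r+2̲ < 3r+2 < 3r+3̲ < 3r+3` have been decided, that is,
when only the remaining letters may be added.  It depends on the largest parts of `s` only; the
cases are to be read in order, longer patterns coming before their initial segments.  For `r = 0`
the patterns that involve the (truncated) contents `3 r - 2`, `3 r - 1` or `3 r` have parts of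
content `0` and so do not occur. -/
noncomputable def tailGF (r : ℕ) : ℕ → List Part → ℤ⟦X⟧⟦X⟧
  | 0, s =>
    if [⟨3 * r, .plus⟩, ⟨3 * r, .minus⟩] <+: s then shiftedSum r 2 2 3 6
    else if [⟨3 * r, .plus⟩] <+: s then shiftedSum r 1 2 3 3
    else if [⟨3 * r, .minus⟩] <+: s then shiftedSum r 1 1 3 3
    else if [⟨3 * r - 1, .plus⟩, ⟨3 * r - 2, .minus⟩] <+: s then shiftedSum r 0 0 0 3
    else shiftedSum r 0 0 0 0
  | 1, s =>
    if [⟨3 * r + 1, .minus⟩] <+: s then shiftedSum r 1 2 3 6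
    else if [⟨3 * r, .plus⟩, ⟨3 * r, .minus⟩] <+: s then shiftedSum r 2 2 3 6
    else if [⟨3 * r, .plus⟩] <+: s then shiftedSum r 1 2 3 3
    else if [⟨3 * r, .minus⟩] <+: s then shiftedSum r 1 1 3 3
    else if [⟨3 * r - 1, .plus⟩, ⟨3 * r - 2, .minus⟩] <+: s then shiftedSum r 0 1 3 3
    else shiftedSum r 1 1 3 3 + xpow 1 (X ^ (3 * r + 1)) * (shiftedSum r 2 3 6 6 +
      xpow 1 (X ^ (3 * r + 2)) * shiftedSum r 3 3 6 6)
  | 2, s =>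
    if [⟨3 * r + 1, .plus⟩, ⟨3 * r - 1, .plus⟩, ⟨3 * r - 2, .minus⟩] <+: s then
      shiftedSum r 2 3 6 6
    else if [⟨3 * r + 1, .plus⟩] <+: s then shiftedSum r 2 3 6 6 +
      xpow 1 (X ^ (3 * r + 2)) * shiftedSum r 3 3 6 6
    else if [⟨3 * r + 1, .minus⟩] <+: s then shiftedSum r 1 2 3 6
    else if [⟨3 * r, .plus⟩, ⟨3 * r, .minus⟩] <+: s then shiftedSum r 2 2 3 6
    else if [⟨3 * r, .plus⟩] <+: s then shiftedSum r 1 2 3 3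
    else shiftedSum r 1 1 3 3
  | 3, s =>
    if [⟨3 * r + 2, .minus⟩] <+: s then shiftedSum r 3 3 6 6
    else if [⟨3 * r + 1, .plus⟩] <+: s then shiftedSum r 2 3 6 6
    else if [⟨3 * r + 1, .minus⟩] <+: s then shiftedSum r 1 2 3 6
    else if [⟨3 * r, .plus⟩, ⟨3 * r, .minus⟩] <+: s then shiftedSum r 2 2 3 6
    else shiftedSum r 1 2 3 3
  | 4, s =>
    if [⟨3 * r + 2, .plus⟩, ⟨3 * r + 1, .minus⟩] <+: s then shiftedSum r 3 3 6 9
    else if [⟨3 * r + 2, .plus⟩] <+: s then shiftedSum r 3 3 6 6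
    else if [⟨3 * r + 2, .minus⟩] <+: s then shiftedSum r 3 3 6 6
    else if [⟨3 * r + 1, .plus⟩] <+: s then shiftedSum r 2 3 6 6
    else if [⟨3 * r + 1, .minus⟩] <+: s then shiftedSum r 2 2 6 6
    else shiftedSum r 2 2 3 6
  | 5, s =>
    if [⟨3 * r + 3, .minus⟩, ⟨3 * r + 1, .minus⟩] <+: s then shiftedSum r 4 4 9 9
    else if [⟨3 * r + 3, .minus⟩] <+: s then shiftedSum r 4 4 9 9 +
      xpow 1 (X ^ (3 * r + 3)) * shiftedSum r 5 5 9 12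
    else if [⟨3 * r + 2, .plus⟩, ⟨3 * r + 1, .minus⟩] <+: s then shiftedSum r 3 3 6 9
    else if [⟨3 * r + 2, .plus⟩] <+: s then shiftedSum r 3 3 6 6
    else if [⟨3 * r + 2, .minus⟩] <+: s then shiftedSum r 3 3 6 6
    else shiftedSum r 2 3 6 6
  | _, _ => 0

theorem not_cons_prefix {s t : List Part} {n : ℕ} (hs : ∀ a ∈ s, 0 < a.cont ∧ a.rank < n)
    {p : Part} (h : n ≤ p.rank) : ¬ p :: t <+: s :=
  fun h' => (hs p (h'.subset List.mem_cons_self)).2.not_ge h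

open Classical in
theorem tailGF_zero {r : ℕ} {s : List Part} (hs : ∀ a ∈ s, 0 < a.cont ∧ a.rank < 6 * r + 2) :
    tailGF r 0 s = tailGF r 1 s + if TopAllowed (⟨3 * r + 1, .minus⟩ :: s) then
      xpow 1 (X ^ (3 * r + 1)) * tailGF r 1 (⟨3 * r + 1, .minus⟩ :: s) else 0 := by
  have h₀ : ¬ [⟨3 * r + 1, .minus⟩] <+: s := not_cons_prefix hs (by simp [Part.rank]; omega)
  have e₁ := shiftedSum_0003 r
  have e₂ := shiftedSum_0000 r
  rw [topAllowed_minus_one_iff hs]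
  obtain _ | ⟨⟨c, _ | _⟩, s⟩ := s
  · simpa [tailGF] using e₂
  all_goals
    simp [tailGF] at *
    grind

open Classical in
theorem tailGF_one {r : ℕ} {s : List Part} (hs : ∀ a ∈ s, 0 < a.cont ∧ a.rank < 6 * r + 3) :
    tailGF r 1 s = tailGF r 2 s + if TopAllowed (⟨3 * r + 1, .plus⟩ :: s) then
      xpow 1 (X ^ (3 * r + 1)) * tailGF r 2 (⟨3 * r + 1, .plus⟩ :: s) else 0 := by
  have h₀ : ¬ [⟨3 * r + 1, .plus⟩] <+: s := not_cons_prefix hs (by simp [Part.rank]; omega)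
  have e₁ := shiftedSum_0133 r
  rw [topAllowed_plus_one_iff hs]
  obtain _ | ⟨⟨c, _ | _⟩, s⟩ := s
  · simp [tailGF]
  all_goals
    simp [tailGF] at *
    grind

open Classical in
theorem tailGF_two {r : ℕ} {s : List Part} (hs : ∀ a ∈ s, 0 < a.cont ∧ a.rank < 6 * r + 4) :
    tailGF r 2 s = tailGF r 3 s + if TopAllowed (⟨3 * r + 2, .minus⟩ :: s) then
      xpow 1 (X ^ (3 * r + 2)) * tailGF r 3 (⟨3 * r + 2, .minus⟩ :: s) else 0 := by
  have h₀ : ¬ [⟨3 * r + 2, .minus⟩] <+: s := not_cons_prefix hs (by simp [Part.rank]; omega)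
  have e₁ := shiftedSum_1133 r
  rw [topAllowed_minus_two_iff hs]
  obtain _ | ⟨⟨c, _ | _⟩, s⟩ := s
  · simpa [tailGF] using e₁
  all_goals
    simp [tailGF] at *
    grind

open Classical in
theorem tailGF_three {r : ℕ} {s : List Part} (hs : ∀ a ∈ s, 0 < a.cont ∧ a.rank < 6 * r + 5) :
    tailGF r 3 s = tailGF r 4 s + if TopAllowed (⟨3 * r + 2, .plus⟩ :: s) then
      xpow 1 (X ^ (3 * r + 2)) * tailGF r 4 (⟨3 * r + 2, .plus⟩ :: s) else 0 := by
  have h₀ : ¬ [⟨3 * r + 2, .plus⟩] <+: s := not_cons_prefix hs (by simp [Part.rank]; omega)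
  have e₁ := shiftedSum_1233 r
  have e₂ := shiftedSum_1236 r
  rw [topAllowed_plus_two_iff hs]
  obtain _ | ⟨⟨c, _ | _⟩, s⟩ := s
  · simpa [tailGF] using e₁
  all_goals
    simp [tailGF] at *
    grind

open Classical in
theorem tailGF_four {r : ℕ} {s : List Part} (hs : ∀ a ∈ s, 0 < a.cont ∧ a.rank < 6 * r + 6) :
    tailGF r 4 s = tailGF r 5 s + if TopAllowed (⟨3 * r + 3, .minus⟩ :: s) then
      xpow 1 (X ^ (3 * r + 3)) * tailGF r 5 (⟨3 * r + 3, .minus⟩ :: s) else 0 := by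
  have h₀ : ¬ [⟨3 * r + 3, .minus⟩] <+: s := not_cons_prefix hs (by simp [Part.rank]; omega)
  have e₁ := shiftedSum_2236 r
  have e₂ := shiftedSum_2266 r
  rw [topAllowed_minus_three_iff hs]
  obtain _ | ⟨⟨c, _ | _⟩, s⟩ := s
  · simpa [tailGF] using e₁
  all_goals
    simp [tailGF] at *
    grind

open Classical in
theorem tailGF_five {r : ℕ} {s : List Part} (hs : ∀ a ∈ s, 0 < a.cont ∧ a.rank < 6 * r + 7) :
    tailGF r 5 s = tailGF (r + 1) 0 s + if TopAllowed (⟨3 * r + 3, .plus⟩ :: s) then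
      xpow 1 (X ^ (3 * r + 3)) * tailGF (r + 1) 0 (⟨3 * r + 3, .plus⟩ :: s) else 0 := by
  have h₀ : ¬ [⟨3 * r + 3, .plus⟩] <+: s := not_cons_prefix hs (by simp [Part.rank]; omega)
  have h₁ : 3 * (r + 1) = 3 * r + 3 := by ring
  have h₂ : 3 * r + 3 - 1 = 3 * r + 2 := by omega
  have h₃ : 3 * r + 3 - 2 = 3 * r + 1 := by omega
  have e₁ := shiftedSum_2366 r
  rw [topAllowed_plus_three_iff hs]
  obtain _ | ⟨⟨c, _ | _⟩, s⟩ := s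
  · simpa [tailGF, h₁, h₂, h₃, shiftedSum_succ_left] using e₁
  all_goals
    simp [tailGF, h₁, h₂, h₃, shiftedSum_succ_left] at *
    grind

/-! ### Adding the letters one at a time -/

/-- The sequence `1̲, 1, 2̲, 2, 3̲, 3, …` of all letters in increasing order. -/
def letter (n : ℕ) : Part := ⟨n / 2 + 1, if n % 2 = 0 then .minus else .plus⟩

theorem rank_letter (n : ℕ) : (letter n).rank = n + 2 := by
  rcases Nat.mod_two_eq_zero_or_one n with h | h <;> simp [letter, Part.rank, h] <;> omega

/-- The closed form `tailGF` for the continuations of `s` by letters from the `n`-th one on. -/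
noncomputable def continuationGF (n : ℕ) (s : List Part) : ℤ⟦X⟧⟦X⟧ := tailGF (n / 6) (n % 6) s

/-- The total weight of a list of parts. -/
noncomputable def listWeight (s : List Part) : ℤ⟦X⟧⟦X⟧ :=
  xpow s.length (X ^ (s.map Part.cont).sum)

theorem listWeight_cons (p : Part) (s : List Part) :
    listWeight (p :: s) = listWeight s * xpow 1 (X ^ p.cont) := by
  rw [listWeight, listWeight, xpow_mul_xpow, ← pow_add, List.map_cons, List.sum_cons,
    add_comm p.cont]
  rfl

open Classical in
/-- The recursion of the generating functions: the `n`-th letter is left out or taken. -/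
theorem continuationGF_eq_add {n : ℕ} {s : List Part}
    (hs : ∀ a ∈ s, 0 < a.cont ∧ a.rank < n + 2) :
    continuationGF n s = continuationGF (n + 1) s + if TopAllowed (letter n :: s) then
      xpow 1 (X ^ (letter n).cont) * continuationGF (n + 1) (letter n :: s) else 0 := by
  obtain ⟨r, t, ht, rfl⟩ : ∃ r t, t < 6 ∧ n = 6 * r + t := ⟨n / 6, n % 6, by omega, by omega⟩
  have hd : (6 * r + t) / 6 = r := by omega
  have hm : (6 * r + t) % 6 = t := by omega
  interval_cases t
  · have hl : letter (6 * r + 0) = ⟨3 * r + 1, .minus⟩ := Part.rank_injective <| by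
      rw [rank_letter]; simp [Part.rank]; ring
    have hd' : (6 * r + 0 + 1) / 6 = r := by omega
    have hm' : (6 * r + 0 + 1) % 6 = 1 := by omega
    rw [continuationGF, continuationGF, continuationGF, hd, hm, hd', hm', hl]
    exact tailGF_zero hs
  · have hl : letter (6 * r + 1) = ⟨3 * r + 1, .plus⟩ := Part.rank_injective <| by
      rw [rank_letter]; simp [Part.rank]; ring
    have hd' : (6 * r + 1 + 1) / 6 = r := by omega
    have hm' : (6 * r + 1 + 1) % 6 = 2 := by omega
    rw [continuationGF, continuationGF, continuationGF, hd, hm, hd', hm', hl]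
    exact tailGF_one hs
  · have hl : letter (6 * r + 2) = ⟨3 * r + 2, .minus⟩ := Part.rank_injective <| by
      rw [rank_letter]; simp [Part.rank]; ring
    have hd' : (6 * r + 2 + 1) / 6 = r := by omega
    have hm' : (6 * r + 2 + 1) % 6 = 3 := by omega
    rw [continuationGF, continuationGF, continuationGF, hd, hm, hd', hm', hl]
    exact tailGF_two hs
  · have hl : letter (6 * r + 3) = ⟨3 * r + 2, .plus⟩ := Part.rank_injective <| by
      rw [rank_letter]; simp [Part.rank]; ring
    have hd' : (6 * r + 3 + 1) / 6 = r := by omega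
    have hm' : (6 * r + 3 + 1) % 6 = 4 := by omega
    rw [continuationGF, continuationGF, continuationGF, hd, hm, hd', hm', hl]
    exact tailGF_three hs
  · have hl : letter (6 * r + 4) = ⟨3 * r + 3, .minus⟩ := Part.rank_injective <| by
      rw [rank_letter]; simp [Part.rank]; ring
    have hd' : (6 * r + 4 + 1) / 6 = r := by omega
    have hm' : (6 * r + 4 + 1) % 6 = 5 := by omega
    rw [continuationGF, continuationGF, continuationGF, hd, hm, hd', hm', hl]
    exact tailGF_four hs
  · have hl : letter (6 * r + 5) = ⟨3 * r + 3, .plus⟩ := Part.rank_injective <| by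
      rw [rank_letter]; simp [Part.rank]; ring
    have hd' : (6 * r + 5 + 1) / 6 = r + 1 := by omega
    have hm' : (6 * r + 5 + 1) % 6 = 0 := by omega
    rw [continuationGF, continuationGF, continuationGF, hd, hm, hd', hm', hl]
    exact tailGF_five hs

/-- The lists of parts in strictly decreasing order without forbidden blocks. -/
def Admissible : List Part → Prop
  | [] => True
  | p :: s => 0 < p.cont ∧ (∀ a ∈ s, a.rank < p.rank) ∧ TopAllowed (p :: s) ∧ Admissible s

theorem Admissible.pos {s : List Part} (hs : Admissible s) : ∀ a ∈ s, 0 < a.cont := by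
  induction s with
  | nil => simp
  | cons p s ih =>
    rintro a (_ | ⟨_, ha⟩)
    · exact hs.1
    · exact ih hs.2.2.2 a ha

open Classical in
/-- The admissible lists all of whose parts are among the letters number `i, …, i + n - 1`. -/
noncomputable def admissibleLists (i : ℕ) : ℕ → Finset (List Part)
  | 0 => {[]}
  | n + 1 => admissibleLists i n ∪
      ((admissibleLists i n).filter fun s => TopAllowed (letter (i + n) :: s)).image
        (List.cons (letter (i + n)))

theorem mem_admissibleLists {i n : ℕ} {s : List Part} :
    s ∈ admissibleLists i n ↔
      Admissible s ∧ ∀ a ∈ s, i + 2 ≤ a.rank ∧ a.rank < i + n + 2 := by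
  induction n generalizing s with
  | zero =>
    rw [admissibleLists, Finset.mem_singleton]
    constructor
    · rintro rfl
      simp [Admissible]
    · rintro ⟨-, h⟩
      exact List.eq_nil_iff_forall_not_mem.mpr fun a ha => by have := h a ha; omega
  | succ n ih =>
    simp only [admissibleLists, Finset.mem_union, Finset.mem_image, Finset.mem_filter, ih]
    constructor
    · rintro (⟨h₁, h₂⟩ | ⟨s, ⟨⟨h₁, h₂⟩, h₃⟩, rfl⟩)
      · exact ⟨h₁, fun a ha => ⟨(h₂ a ha).1, by have := (h₂ a ha).2; omega⟩⟩
      · refine ⟨⟨Nat.succ_pos _, fun a ha => ?_, h₃, h₁⟩, ?_⟩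
        · rw [rank_letter]
          exact (h₂ a ha).2
        · rintro a (_ | ⟨_, ha⟩)
          · rw [rank_letter]
            omega
          · have := h₂ a ha
            omega
    · rintro ⟨h₁, h₂⟩
      obtain _ | ⟨p, s⟩ := s
      · exact Or.inl ⟨h₁, by simp⟩
      have hp := h₂ p List.mem_cons_self
      obtain ⟨h₃, h₄, h₅, h₆⟩ := h₁
      rcases Nat.lt_or_ge p.rank (i + n + 2) with hlt | hge
      · refine Or.inl ⟨⟨h₃, h₄, h₅, h₆⟩, ?_⟩
        rintro a (_ | ⟨_, ha⟩)
        · exact ⟨hp.1, hlt⟩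
        · exact ⟨(h₂ a (List.mem_cons_of_mem _ ha)).1, (h₄ a ha).trans hlt⟩
      · obtain rfl : letter (i + n) = p := Part.rank_injective <| by
          rw [rank_letter]; omega
        refine Or.inr ⟨s, ⟨⟨h₆, fun a ha => ⟨(h₂ a (List.mem_cons_of_mem _ ha)).1, ?_⟩⟩, h₅⟩, rfl⟩
        have := h₄ a ha
        rwa [rank_letter] at this

/-- The recursion iterated over the letters number `i, …, i + n - 1`. -/
theorem continuationGF_nil_eq_sum (i n : ℕ) :
    continuationGF i [] =
      ∑ s ∈ admissibleLists i n, listWeight s * continuationGF (i + n) s := by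
  classical
  induction n with
  | zero => simp [admissibleLists, listWeight, xpow]
  | succ n ih =>
    have hlt : ∀ s ∈ admissibleLists i n, ∀ a ∈ s, 0 < a.cont ∧ a.rank < i + n + 2 :=
      fun s hs a ha => ⟨(mem_admissibleLists.mp hs).1.pos a ha, ((mem_admissibleLists.mp hs).2 a ha).2⟩
    rw [ih, admissibleLists, Finset.sum_union,
      Finset.sum_image (fun _ _ _ _ h => (List.cons.inj h).2), Finset.sum_filter, ← Finset.sum_add_distrib]
    · refine Finset.sum_congr rfl fun s hs => ?_
      rw [continuationGF_eq_add (hlt s hs), mul_add, mul_ite, mul_zero, listWeight_cons, mul_assoc]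
      rfl
    · rw [Finset.disjoint_left]
      intro s hs hs'
      obtain ⟨s, -, rfl⟩ := Finset.mem_image.mp hs'
      have := (hlt _ hs _ List.mem_cons_self).2
      rw [rank_letter] at this
      exact lt_irrefl _ this

theorem coeff_coeff_xpow_mul_of_lt {n j : ℕ} (h : n < j) (m i : ℕ) (f : ℤ⟦X⟧⟦X⟧) :
    coeff n (coeff m (xpow i (X ^ j) * f)) = 0 := by
  rw [coeff_coeff_xpow_mul, if_neg fun h' => h'.2.not_gt h]

theorem coeff_coeff_shiftedSum {r n : ℕ} (h : n < 3 * r) (m i j k l : ℕ) :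
    coeff n (coeff m (shiftedSum r i j k l)) = if m = 0 ∧ n = 0 then 1 else 0 :=
  coeff_coeff_quadSum (by omega) (by omega) (by omega) (by omega)

theorem coeff_coeff_tailGF {r n t : ℕ} (ht : t < 6) (h : n < 3 * r) (m : ℕ) (s : List Part) :
    coeff n (coeff m (tailGF r t s)) = if m = 0 ∧ n = 0 then 1 else 0 := by
  have h₀ := coeff_coeff_shiftedSum h m
  have h₁ := fun f => coeff_coeff_xpow_mul_of_lt (show n < 3 * r + 1 by omega) m 1 f
  have h₂ := fun f => coeff_coeff_xpow_mul_of_lt (show n < 3 * r + 2 by omega) m 1 f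
  have h₃ := fun f => coeff_coeff_xpow_mul_of_lt (show n < 3 * r + 3 by omega) m 1 f
  generalize (if m = 0 ∧ n = 0 then (1 : ℤ) else 0) = e at h₀ ⊢
  interval_cases t <;> simp only [tailGF] <;> split_ifs <;>
    simp only [map_add, h₀, h₁, h₂, h₃, add_zero]

/-- Only the empty continuation contributes when the letters still available are large. -/
theorem coeff_coeff_mul_continuationGF {n N : ℕ} (hN : 2 * n + 6 ≤ N) (i j m : ℕ) (s : List Part) :
    coeff n (coeff m (xpow i (X ^ j) * continuationGF N s)) =
      coeff n (coeff m (xpow i (X ^ j))) := by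
  rw [← mul_one (xpow i (X ^ j)), mul_assoc, coeff_coeff_xpow_mul, coeff_coeff_xpow_mul, one_mul]
  split_ifs
  · rw [continuationGF, coeff_coeff_tailGF (Nat.mod_lt _ (by norm_num)) (by omega), coeff_one]
    rcases eq_or_ne (m - i) 0 with h | h <;> simp [h, coeff_one]
  · rfl

/-- A given coefficient is read off from `continuationGF_nil_eq_sum` with sufficiently many letters:
there every continuation counts as `1`, and the admissible lists with larger parts have too large
a size to contribute. -/
theorem hasSum_listWeight (i : ℕ) :
    HasSum (fun s : {s : List Part | Admissible s ∧ ∀ a ∈ s, i + 2 ≤ a.rank} => listWeight s.1)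
      (continuationGF i []) := by
  rw [WithPiTopology.hasSum_iff_hasSum_coeff]
  intro m
  rw [WithPiTopology.hasSum_iff_hasSum_coeff]
  intro n
  have hsum : coeff n (coeff m (continuationGF i [])) =
      ∑ s ∈ admissibleLists i (2 * n + 6), coeff n (coeff m (listWeight s)) := by
    rw [continuationGF_nil_eq_sum i (2 * n + 6), map_sum, map_sum]
    exact Finset.sum_congr rfl fun s _ => coeff_coeff_mul_continuationGF (by omega) _ _ _ _
  have hsum' : coeff n (coeff m (continuationGF i [])) =
      ∑ s ∈ admissibleLists i (2 * n + 6),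
        {s : List Part | Admissible s ∧ ∀ a ∈ s, i + 2 ≤ a.rank}.indicator
          (fun s => coeff n (coeff m (listWeight s))) s := by
    rw [hsum]
    refine Finset.sum_congr rfl fun s hs => ?_
    rw [mem_admissibleLists] at hs
    exact (Set.indicator_of_mem (s := {s : List Part | Admissible s ∧ ∀ a ∈ s, i + 2 ≤ a.rank})
      ⟨hs.1, fun a ha => (hs.2 a ha).1⟩ fun s => coeff n (coeff m (listWeight s))).symm
  rw [hsum']
  refine (hasSum_subtype_iff_indicator
    (f := fun s => coeff n (coeff m (listWeight s)))).mpr (hasSum_sum_of_ne_finset_zero ?_)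
  intro s hs
  refine Set.indicator_apply_eq_zero.mpr fun ⟨h₁, h₂⟩ => ?_
  obtain ⟨a, ha, hrank⟩ : ∃ a ∈ s, i + (2 * n + 6) + 2 ≤ a.rank := by
    by_contra! h
    exact hs (mem_admissibleLists.mpr ⟨h₁, fun a ha => ⟨h₂ a ha, h a ha⟩⟩)
  have hcont : n < a.cont := by
    rw [Part.rank] at hrank
    split_ifs at hrank <;> omega
  have hsize : n < (s.map Part.cont).sum :=
    hcont.trans_le (List.le_sum_of_mem (List.mem_map_of_mem ha))
  rw [listWeight, ← mul_one (xpow _ _), coeff_coeff_xpow_mul_of_lt hsize]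

/-! ### Admissible lists and 2-colored partitions -/

/-- The conditions (D1)–(D3) say exactly that there is no forbidden block. -/
theorem forall_not_infix_iff (l : Partition) :
    l.D1 ∧ l.D2 ∧ l.D3 ↔ ∀ m, Forbidden m → ¬ m <:+: l.parts := by
  constructor
  · rintro ⟨h₁, h₂, h₃⟩ m hm hl
    cases hm with
    | close p r hc h => exact h (h₁ p r hl hc)
    | gap c h => exact h₂ _ _ hl rfl h ⟨rfl, rfl⟩
    | above k hk => exact (h₃ k hk).1 hl
    | below k hk => exact (h₃ k hk).2.1 hl
    | chain k hk => exact (h₃ k hk).2.2 hl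
  · refine fun h => ⟨fun p r hl hc => ?_, ?_, fun k hk => ⟨?_, ?_, ?_⟩⟩
    · by_contra h'
      exact h _ (.close p r hc h') hl
    · rintro ⟨_, _⟩ ⟨c, _⟩ hl rfl h' ⟨rfl, rfl⟩
      exact h _ (.gap c h') hl
    · exact h _ (.above k hk)
    · exact h _ (.below k hk)
    · exact h _ (.chain k hk)

theorem forall_not_infix_cons_iff (p : Part) (s : List Part) :
    (∀ m, Forbidden m → ¬ m <:+: p :: s) ↔
      TopAllowed (p :: s) ∧ ∀ m, Forbidden m → ¬ m <:+: s := by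
  simp only [List.infix_cons_iff, not_or, TopAllowed]
  exact ⟨fun h => ⟨fun m hm => (h m hm).1, fun m hm => (h m hm).2⟩,
    fun h m hm => ⟨h.1 m hm, h.2 m hm⟩⟩

/-- Equal consecutive parts form a forbidden block, so that weakly decreasing lists without
forbidden blocks are strictly decreasing. -/
theorem admissible_iff (s : List Part) :
    Admissible s ↔ (∀ p ∈ s, 0 < p.cont) ∧ s.Pairwise (fun p r => r ≤ p) ∧
      ∀ m, Forbidden m → ¬ m <:+: s := by
  induction s with
  | nil =>
    refine ⟨fun _ => ⟨by simp, List.Pairwise.nil, ?_⟩, fun _ => trivial⟩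
    rintro m (_ | _ | _ | _ | _) <;> simp
  | cons p s ih =>
    rw [Admissible, ih, forall_not_infix_cons_iff, List.pairwise_cons, List.forall_mem_cons]
    constructor
    · rintro ⟨h₁, h₂, h₃, h₄, h₅, h₆⟩
      exact ⟨⟨h₁, h₄⟩, ⟨fun a ha => (Part.le_iff_rank_le _ _).mpr (h₂ a ha).le, h₅⟩, h₃, h₆⟩
    · rintro ⟨⟨h₁, h₄⟩, ⟨h₂, h₅⟩, h₃, h₆⟩
      refine ⟨h₁, fun a ha => ?_, h₃, h₄, h₅, h₆⟩
      obtain _ | ⟨b, s⟩ := s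
      · simp at ha
      have hb : b.rank < p.rank := by
        refine lt_of_le_of_ne ((Part.le_iff_rank_le _ _).mp (h₂ b List.mem_cons_self)) fun h => ?_
        obtain rfl := Part.rank_injective h
        exact h₃ _ (.close b b (Nat.le_succ _) fun h => h.2 rfl) ⟨s, rfl⟩
      rcases List.mem_cons.mp ha with rfl | ha
      · exact hb
      · exact ((Part.le_iff_rank_le _ _).mp ((List.pairwise_cons.mp h₅).1 a ha)).trans_lt hb

theorem two_le_rank {a : Part} (ha : 0 < a.cont) : 2 ≤ a.rank := by
  rw [Part.rank]
  omega

theorem d4_iff (l : Partition) : l.D4 ↔ ∀ a ∈ l.parts, 5 ≤ a.rank := by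
  constructor
  · rintro ⟨h₁, h₂, h₃⟩ a ha
    have hpos := l.pos a ha
    by_contra! h
    obtain ⟨c, _ | _⟩ := a <;> simp only [Part.rank, if_true, reduceCtorEq, if_false] at h hpos
    · obtain rfl : c = 1 := by omega
      exact h₁ ha
    · obtain rfl | rfl : c = 1 ∨ c = 2 := by omega
      · exact h₂ ha
      · exact h₃ ha
  · exact fun h => ⟨fun h' => by simpa [Part.rank] using h _ h',
      fun h' => by simpa [Part.rank] using h _ h', fun h' => by simpa [Part.rank] using h _ h'⟩

theorem parts_injective : Function.Injective Partition.parts := fun _ _ => Partition.ext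

theorem range_parts_BIR :
    Set.range (fun l : BIR => l.1.parts) = {s | Admissible s ∧ ∀ a ∈ s, 0 + 2 ≤ a.rank} := by
  ext s
  constructor
  · rintro ⟨⟨l, hl⟩, rfl⟩
    exact ⟨(admissible_iff _).mpr ⟨l.pos, l.decreasing, (forall_not_infix_iff l).mp hl⟩,
      fun a ha => two_le_rank (l.pos a ha)⟩
  · rintro ⟨hs, -⟩
    obtain ⟨h₁, h₂, h₃⟩ := (admissible_iff s).mp hs
    exact ⟨⟨⟨s, h₁, h₂⟩, (forall_not_infix_iff ⟨s, h₁, h₂⟩).mpr h₃⟩, rfl⟩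

theorem range_parts_BIRP :
    Set.range (fun l : BIRP => l.1.parts) = {s | Admissible s ∧ ∀ a ∈ s, 3 + 2 ≤ a.rank} := by
  ext s
  constructor
  · rintro ⟨⟨l, h₁, h₂, h₃, h₄⟩, rfl⟩
    exact ⟨(admissible_iff _).mpr ⟨l.pos, l.decreasing,
      (forall_not_infix_iff l).mp ⟨h₁, h₂, h₃⟩⟩, (d4_iff l).mp h₄⟩
  · rintro ⟨hs, h₄⟩
    obtain ⟨h₁, h₂, h₃⟩ := (admissible_iff s).mp hs
    obtain ⟨h₅, h₆, h₇⟩ := (forall_not_infix_iff ⟨s, h₁, h₂⟩).mpr h₃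
    exact ⟨⟨⟨s, h₁, h₂⟩, h₅, h₆, h₇, (d4_iff ⟨s, h₁, h₂⟩).mpr h₄⟩, rfl⟩

theorem hasSum_weight_BIR :
    HasSum (fun l : BIR => weight l.1) (quadSum 0 0 0 0) := by
  have h := hasSum_listWeight 0
  rw [← range_parts_BIR] at h
  have h₀ : continuationGF 0 [] = quadSum 0 0 0 0 := by simp [continuationGF, tailGF, shiftedSum]
  rw [← h₀]
  exact ((parts_injective.comp Subtype.val_injective).hasSum_range_iff (f := listWeight)).mp h

theorem hasSum_weight_BIRP :
    HasSum (fun l : BIRP => weight l.1) (quadSum 1 2 3 3) := by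
  have h := hasSum_listWeight 3
  rw [← range_parts_BIRP] at h
  have h₀ : continuationGF 3 [] = quadSum 1 2 3 3 := by simp [continuationGF, tailGF, shiftedSum]
  rw [← h₀]
  exact ((parts_injective.comp Subtype.val_injective).hasSum_range_iff (f := listWeight)).mp h

end TwoColored

theorem theorem1p4 :
    (Summable (fun l : TwoColored.BIR => TwoColored.weight l.1) ∧
      Summable (fun t : ℕ × ℕ × ℕ × ℕ => TwoColored.termBIR t.1 t.2.1 t.2.2.1 t.2.2.2) ∧
      ∑' l : TwoColored.BIR, TwoColored.weight l.1 =
        ∑' t : ℕ × ℕ × ℕ × ℕ, TwoColored.termBIR t.1 t.2.1 t.2.2.1 t.2.2.2) ∧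
    (Summable (fun l : TwoColored.BIRP => TwoColored.weight l.1) ∧
      Summable (fun t : ℕ × ℕ × ℕ × ℕ => TwoColored.termBIRP t.1 t.2.1 t.2.2.1 t.2.2.2) ∧
      ∑' l : TwoColored.BIRP, TwoColored.weight l.1 =
        ∑' t : ℕ × ℕ × ℕ × ℕ, TwoColored.termBIRP t.1 t.2.1 t.2.2.1 t.2.2.2) := by
  simp only [TwoColored.termBIR_eq_quadTerm, TwoColored.termBIRP_eq_quadTerm]
  exact ⟨⟨TwoColored.hasSum_weight_BIR.summable, TwoColored.summable_quadTerm 0 0 0 0,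
      TwoColored.hasSum_weight_BIR.tsum_eq⟩,
    TwoColored.hasSum_weight_BIRP.summable, TwoColored.summable_quadTerm 1 2 3 3,
    TwoColored.hasSum_weight_BIRP.tsum_eq⟩
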